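/- A (feedforward ReLU) neural network on $\mathbb{R}^n$ is a function $F:\mathbb{R}^n\to\mathbb{R}$ given by finitely many (possibly zero) hidden layers $X_l=\mathrm{ReLU}(W_lX_{l-1}+b_l)\in\mathbb{R}^{n_l}$, $X_0=x$, followed by an affine output layer; its width is $\max_l n_l$ over the hidden layers ($0$ if there are none). A dataset in dimension $n$ is a finite set $S\subset[0,1]^n\times\{-1,1\}$ in which no point occurs with both labels. A memorization algorithm $\mathcal{L}$ assigns to every $n\ge 1$ and every dataset $S$ in dimension $n$ a network $\mathcal{L}(S)$ on $\mathbb{R}^n$ with $\mathrm{sign}(\mathcal{L}(S)(x))=y$ for all $(x,y)\in S$. For $c>0$, $\mathcal{D}(n,c)$ is the set of probability distributions $\mathcal{D}$ on $[0,1]^n\times\{-1,1\}$ such that $\|x-z\|_2\ge c$ whenever $(x,1)$ and $(z,-1)$ are in the support of $\mathcal{D}$. The accuracy of a network $F$ is $A_{\mathcal{D}}(F)=\Pr_{(x,y)\sim\mathcal{D}}(\mathrm{sign}(F(x))=y)$, where $\mathrm{sign}(0)=0$. **Theorem (fixed width precludes generalization).** Let $w\ge 1$ be an integer and let $\mathcal{L}$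 be a memorization algorithm such that $\mathcal{L}(S)$ has width at most $w$ for every dataset $S$ in every dimension $n\ge 1$. Then there exist an integer $n>w$, a real number $c>0$ and a distribution $\mathcal{D}\in\mathcal{D}(n,c)$ such that, for every $N$ and every sample $\mathcal{D}_{tr}$ in the support of $\mathcal{D}^N$ (regarded as the set of its entries), $$A_{\mathcal{D}}(\mathcal{L}(\mathcal{D}_{tr}))\le 0.51 .$$ Moreover, $\mathcal{D}$ can be chosen of the following form: for some $q\in\mathbb{R}^n$ and $0<r_1<r_2<r_3$, it is the uniform distribution on the ball $\{\|x-q\|_2\le r_1\}$, whose points have label $1$, together with the shell $\{r_2<\|x-q\|_2\le r_3\}$, whose points have label $-1$, with the same constant density on both. -/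

import Mathlib

open MeasureTheory

noncomputable section

/-- A fully connected feedforward ReLU network with input dimension `n` and real output:
some number (possibly zero) of hidden layers `X ↦ ReLU (W X + b)`, followed by an affine
output layer. -/
inductive Network : ℕ → Type
  | output {n : ℕ} (W : Fin n → ℝ) (b : ℝ) : Network n
  | hidden {n k : ℕ} (W : Matrix (Fin k) (Fin n) ℝ) (b : Fin k → ℝ) (rest : Network k) :
      Network n

namespace Network

/-- The function computed by a network. -/
def eval : {n : ℕ} → Network n → (Fin n → ℝ) → ℝ
  | _, output W b, x => W ⬝ᵥ x + b
  | _, hidden W b rest, x => rest.eval (fun i => max ((W.mulVec x + b) i) 0)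

/-- The width: the maximal number of nodes in a hidden layer (`0` if there is none). -/
def width : {n : ℕ} → Network n → ℕ
  | _, output _ _ => 0
  | _, @hidden _ k _ _ rest => max k rest.width

end Network

/-- Labelled points: a point of Euclidean space `ℝⁿ` with a real label. -/
abbrev Labelled (n : ℕ) : Type := EuclideanSpace ℝ (Fin n) × ℝ

/-- The data space `[0,1]ⁿ × {-1,1}`. -/
def dataSpace (n : ℕ) : Set (Labelled n) :=
  {p | (∀ i, p.1 i ∈ Set.Icc (0 : ℝ) 1) ∧ (p.2 = -1 ∨ p.2 = 1)}

/-- A (finite) dataset: a finite subset of `[0,1]ⁿ × {-1,1}` in which no point carries two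
different labels. -/
def IsDataset {n : ℕ} (S : Finset (Labelled n)) : Prop :=
  (∀ p ∈ S, p ∈ dataSpace n) ∧ ∀ p ∈ S, ∀ q ∈ S, p.1 = q.1 → p.2 = q.2

/-- The network gives the right label to the labelled point `p`. -/
def Network.Correct {n : ℕ} (F : Network n) (p : Labelled n) : Prop :=
  Real.sign (F.eval p.1.ofLp) = p.2

/-- The network memorizes the finite set `S`. -/
def Network.Memorizes {n : ℕ} (F : Network n) (S : Finset (Labelled n)) : Prop :=
  ∀ p ∈ S, F.Correct p

/-- A memorization algorithm maps each dataset in each positive dimension to a network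
memorizing it. The values on finite sets that are not datasets are irrelevant. -/
def IsMemorizationAlgorithm (L : (n : ℕ) → Finset (Labelled n) → Network n) : Prop :=
  ∀ n : ℕ, 0 < n → ∀ S : Finset (Labelled n), IsDataset S → (L n S).Memorizes S

/-- The probability distributions on `[0,1]ⁿ × {-1,1}` for which points with label `1` and
points with label `-1` have Euclidean distance at least `c`. -/
def separatedDistributions (n : ℕ) (c : ℝ) : Set (Measure (Labelled n)) :=
  {D | IsProbabilityMeasure D ∧ (∀ᵐ p ∂D, p ∈ dataSpace n) ∧
    ∀ p ∈ D.support, ∀ q ∈ D.support, p.2 = 1 → q.2 = -1 → c ≤ ‖p.1 - q.1‖}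

/-- The accuracy of a network on a distribution. -/
def accuracy {n : ℕ} (D : Measure (Labelled n)) (F : Network n) : ℝ :=
  D.real {p | F.Correct p}

/-- The uniform distribution on the union of the ball of radius `r₁` around `q`, labelled `1`,
and the shell of radii `r₂` and `r₃` around `q`, labelled `-1`. -/
def ballShell {n : ℕ} (q : EuclideanSpace ℝ (Fin n)) (r₁ r₂ r₃ : ℝ) : Measure (Labelled n) :=
  (volume (Metric.closedBall q r₁) +
      volume (Metric.closedBall q r₃ \ Metric.closedBall q r₂))⁻¹ •
    ((volume.restrict (Metric.closedBall q r₁)).map (fun x => (x, (1 : ℝ))) +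
      (volume.restrict (Metric.closedBall q r₃ \ Metric.closedBall q r₂)).map
        (fun x => (x, (-1 : ℝ))))

open Classical in
/-- The finite set of values of a sample. -/
def sampleSet {n N : ℕ} (s : Fin N → Labelled n) : Finset (Labelled n) :=
  Finset.univ.image s

end

/-! A network of width at most `w` depends on its input only through a linear map of rank at most
`w`, so its positivity set `A` is invariant under a subspace `K` of dimension at least `n - w`
(`exists_submodule_eval_add`). Dilating by `μ` along `K` preserves `A` and sends a ball into the
`μ`-times larger one, so the measure of `A` in the ball grows by at least `μ ^ dim K`
(`pow_finrank_mul_measure_closedBall_inter_le`). If `μ ^ n = 2` and `n` is large compared with `w`,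
this factor is almost 2: the shell holds almost as much of `A` as the ball inside it. Whatever is
gained on the points labelled 1 is thus lost again on the shell (`accuracy_ballShell_le`). The two
classes have nearly equal mass, so the accuracy is near 1/2, whichever network the sample produces.
-/

theorem exists_one_lt_pow_eq {a : ℝ} (ha : 1 < a) {n : ℕ} (hn : n ≠ 0) :
    ∃ r : ℝ, 1 < r ∧ r ^ n = a :=
  ⟨a ^ (n⁻¹ : ℝ), Real.one_lt_rpow ha (by positivity),
    Real.rpow_inv_natCast_pow (by linarith) hn⟩

/-! ### Translation invariance of narrow networks -/

namespace Network

theorem continuous_eval : ∀ {n : ℕ} (F : Network n), Continuous F.eval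
  | _, output W b => by
    change Continuous fun x => W ⬝ᵥ x + b
    exact (continuous_const.dotProduct continuous_id).add continuous_const
  | _, hidden W b rest => by
    change Continuous fun x => rest.eval fun i => max ((W.mulVec x + b) i) 0
    refine (continuous_eval rest).comp (continuous_pi fun i => ?_)
    have h : Continuous fun x => W.mulVec x + b :=
      (continuous_const.matrix_mulVec continuous_id).add continuous_const
    exact ((continuous_apply i).comp h).max continuous_const

/-- A network only sees its input through the linear map of its first layer. -/
theorem exists_linearMap_eval_eq {n : ℕ} (F : Network n) :
    ∃ k : ℕ, k ≤ max 1 F.width ∧ ∃ P : (Fin n → ℝ) →ₗ[ℝ] (Fin k → ℝ),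
      ∀ x y, P x = P y → F.eval x = F.eval y := by
  cases F with
  | output W b =>
    -- Without hidden layers the width is 0 but the rank can be 1, hence the `max 1`.
    refine ⟨1, le_max_left _ _, Matrix.mulVecLin (fun _ => W), fun x y h => ?_⟩
    have h0 : W ⬝ᵥ x = W ⬝ᵥ y := congrFun h 0
    simp only [eval, h0]
  | @hidden _ k W b rest =>
    refine ⟨k, le_max_of_le_right (le_max_left _ _), W.mulVecLin, fun x y h => ?_⟩
    have h0 : W.mulVec x = W.mulVec y := h
    simp only [eval, h0]

/-- A network of width at most `w` is invariant under translation by a subspace of codimension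
at most `w`. -/
theorem exists_submodule_eval_add {n w : ℕ} (hw : 0 < w) (F : Network n) (hF : F.width ≤ w) :
    ∃ K : Submodule ℝ (EuclideanSpace ℝ (Fin n)), n ≤ w + Module.finrank ℝ K ∧
      ∀ x, ∀ k ∈ K, F.eval (x + k).ofLp = F.eval x.ofLp := by
  obtain ⟨k, hk, P, hP⟩ := F.exists_linearMap_eval_eq
  let T : EuclideanSpace ℝ (Fin n) →ₗ[ℝ] (Fin k → ℝ) :=
    P ∘ₗ (WithLp.linearEquiv 2 ℝ (Fin n → ℝ)).toLinearMap
  refine ⟨LinearMap.ker T, ?_, fun x z hz => hP _ _ ?_⟩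
  · have h1 := LinearMap.finrank_range_add_finrank_ker T
    rw [finrank_euclideanSpace_fin] at h1
    have h2 : Module.finrank ℝ (LinearMap.range T) ≤ k := by
      simpa using Submodule.finrank_le (LinearMap.range T)
    have h4 : max 1 F.width ≤ w := max_le hw hF
    omega
  · have hz' : P z.ofLp = 0 := hz
    rw [WithLp.ofLp_add, map_add, hz', add_zero]

end Network

/-! ### Dilation along a subspace -/

section Dilation

variable {E : Type*} [NormedAddCommGroup E] [InnerProductSpace ℝ E] [FiniteDimensional ℝ E]

/-- The dilation by `t` along a subspace `K`, fixing the orthogonal complement. -/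
theorem exists_dilation_along (K : Submodule ℝ E) {t : ℝ} (ht : 1 ≤ t) :
    ∃ T : E →ₗ[ℝ] E, LinearMap.det T = t ^ Module.finrank ℝ K ∧
      (∀ x, T x - x ∈ K) ∧ ∀ x, ‖T x‖ ≤ t * ‖x‖ := by
  let e := Submodule.prodEquivOfIsCompl K Kᗮ K.isCompl_orthogonal
  let S : (K × Kᗮ) →ₗ[ℝ] (K × Kᗮ) := LinearMap.prodMap (t • LinearMap.id) LinearMap.id
  have hT : ∀ p : K × Kᗮ, (e.toLinearMap ∘ₗ S ∘ₗ e.symm.toLinearMap) (e p)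
      = t • (p.1 : E) + p.2 := by
    intro p
    simp [e, S]
  refine ⟨e.toLinearMap ∘ₗ S ∘ₗ e.symm.toLinearMap, ?_, fun x => ?_, fun x => ?_⟩
  · rw [LinearMap.det_conj]
    simp [S, LinearMap.det_prodMap]
  · obtain ⟨p, rfl⟩ := e.surjective x
    rw [hT]
    have h : t • (p.1 : E) + p.2 - e p = (t - 1) • (p.1 : E) := by
      simp only [e, Submodule.coe_prodEquivOfIsCompl']
      module
    rw [h]
    exact K.smul_mem _ p.1.2
  · obtain ⟨p, rfl⟩ := e.surjective x
    rw [hT]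
    have hep : e p = (p.1 : E) + p.2 := by simp [e]
    have horth : inner ℝ (p.1 : E) (p.2 : E) = 0 :=
      Submodule.inner_right_of_mem_orthogonal p.1.2 p.2.2
    have h1 : ‖t • (p.1 : E) + p.2‖ ^ 2 = t ^ 2 * ‖(p.1 : E)‖ ^ 2 + ‖(p.2 : E)‖ ^ 2 := by
      rw [norm_add_sq_real, inner_smul_left, horth, norm_smul, mul_pow, Real.norm_eq_abs, sq_abs]
      simp
    have h2 : ‖e p‖ ^ 2 = ‖(p.1 : E)‖ ^ 2 + ‖(p.2 : E)‖ ^ 2 := by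
      rw [hep, norm_add_sq_real, horth]
      simp
    refine abs_le_of_sq_le_sq' ?_ (by positivity) |>.2
    rw [h1, mul_pow, h2]
    nlinarith [sq_nonneg ‖(p.2 : E)‖, mul_nonneg (by nlinarith : 0 ≤ t ^ 2 - 1)
      (sq_nonneg ‖(p.2 : E)‖)]

variable [MeasurableSpace E] [BorelSpace E]

/-- Enlarging a ball by a factor `t` multiplies the measure of its intersection with a set
invariant under translations along `K` by at least `t ^ dim K`. -/
theorem pow_finrank_mul_measure_closedBall_inter_le (μ : Measure E) [μ.IsAddHaarMeasure]
    (K : Submodule ℝ E) {A : Set E} (hA : ∀ x ∈ A, ∀ k ∈ K, x + k ∈ A)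
    {t : ℝ} (ht : 1 ≤ t) (q : E) (r : ℝ) :
    ENNReal.ofReal (t ^ Module.finrank ℝ K) * μ (Metric.closedBall q r ∩ A) ≤
      μ (Metric.closedBall q (t * r) ∩ A) := by
  obtain ⟨T, hdet, hK, hnorm⟩ := exists_dilation_along K ht
  -- Recentring at `q` lets the linear map act; since `T x - x ∈ K`, it does not leave `A`.
  have key : T '' ((fun x => x + q) ⁻¹' (Metric.closedBall q r ∩ A)) ⊆
      (fun x => x + q) ⁻¹' (Metric.closedBall q (t * r) ∩ A) := by
    rintro _ ⟨x, ⟨hx, hxA⟩, rfl⟩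
    refine ⟨?_, ?_⟩
    · simp only [Metric.mem_closedBall, dist_eq_norm, add_sub_cancel_right] at hx ⊢
      exact (hnorm x).trans (mul_le_mul_of_nonneg_left hx (by linarith))
    · have := hA _ hxA _ (hK x)
      rwa [show x + q + (T x - x) = T x + q by abel] at this
  have h := measure_mono (μ := μ) key
  rwa [Measure.addHaar_image_linearMap, measure_preimage_add_right, measure_preimage_add_right,
    hdet, abs_of_nonneg (by positivity)] at h

end Dilation

/-! ### Datasets and supports -/

theorem isDataset_sampleSet {n N : ℕ} {s : Fin N → Labelled n}
    (h1 : ∀ i, s i ∈ dataSpace n) (h2 : ∀ i j, (s i).1 = (s j).1 → (s i).2 = (s j).2) :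
    IsDataset (sampleSet s) := by
  constructor
  · intro p hp
    obtain ⟨i, -, rfl⟩ := Finset.mem_image.1 hp
    exact h1 i
  · intro p hp p' hp'
    obtain ⟨i, -, rfl⟩ := Finset.mem_image.1 hp
    obtain ⟨j, -, rfl⟩ := Finset.mem_image.1 hp'
    exact h2 i j

theorem isClosed_dataSpace (n : ℕ) : IsClosed (dataSpace n) := by
  have h : dataSpace n = (⋂ i, (fun p : Labelled n => p.1 i) ⁻¹' Set.Icc (0 : ℝ) 1) ∩
      Prod.snd ⁻¹' {-1, 1} := by
    ext p
    simp [dataSpace]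
  rw [h]
  refine (isClosed_iInter fun i => isClosed_Icc.preimage ?_).inter
    (IsClosed.preimage continuous_snd (Set.Finite.isClosed (by simp)))
  fun_prop

theorem Measure.support_subset_of_ae_mem {X : Type*} [TopologicalSpace X] [MeasurableSpace X]
    {μ : Measure X} {C : Set X} (hC : IsClosed C) (h : ∀ᵐ x ∂μ, x ∈ C) : μ.support ⊆ C := by
  intro x hx
  by_contra hxC
  rw [Measure.mem_support_iff_forall] at hx
  exact (hx _ (hC.isOpen_compl.mem_nhds hxC)).ne' h

theorem Measure.apply_mem_support_of_mem_support_pi {ι X : Type*} [Fintype ι]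
    [TopologicalSpace X] [MeasurableSpace X] [OpensMeasurableSpace X] {μ : Measure X}
    [IsProbabilityMeasure μ] {s : ι → X} (hs : s ∈ (Measure.pi fun _ : ι => μ).support) (i : ι) :
    s i ∈ μ.support := by
  rw [Measure.mem_support_iff_forall] at hs ⊢
  intro U hU
  obtain ⟨V, hVU, hV, hsV⟩ := mem_nhds_iff.1 hU
  have h := hs (Function.eval i ⁻¹' V)
    ((hV.preimage (continuous_apply i)).mem_nhds hsV)
  rw [(measurePreserving_eval (fun _ : ι => μ) i).measure_preimage
    hV.measurableSet.nullMeasurableSet] at h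
  exact h.trans_le (measure_mono hVU)

/-- The ball of radius `1 / 2` around the centre of the unit cube lies in the cube. -/
theorem mem_Icc_of_mem_closedBall_half {n : ℕ} {x : EuclideanSpace ℝ (Fin n)}
    (hx : x ∈ Metric.closedBall (WithLp.toLp 2 fun _ => (1 / 2 : ℝ)) (1 / 2)) (i : Fin n) :
    x i ∈ Set.Icc (0 : ℝ) 1 := by
  rw [Metric.mem_closedBall, dist_eq_norm] at hx
  have h := (PiLp.norm_apply_le _ i).trans hx
  simp only [PiLp.sub_apply, Real.norm_eq_abs, abs_le] at h
  exact ⟨by linarith, by linarith⟩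

/-! ### The ball-and-shell distribution -/

section BallShell

variable {n : ℕ} {q : EuclideanSpace ℝ (Fin n)} {r₁ r₂ r₃ : ℝ}

theorem volume_closedBall_add_ne_top :
    volume (Metric.closedBall q r₁) +
      volume (Metric.closedBall q r₃ \ Metric.closedBall q r₂) ≠ ⊤ :=
  ENNReal.add_ne_top.2 ⟨measure_closedBall_lt_top.ne,
    ((measure_mono Set.sdiff_subset).trans_lt measure_closedBall_lt_top).ne⟩

theorem ballShell_apply {s : Set (Labelled n)} (hs : MeasurableSet s) :
    ballShell q r₁ r₂ r₃ s = (volume (Metric.closedBall q r₁) +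
      volume (Metric.closedBall q r₃ \ Metric.closedBall q r₂))⁻¹ *
      (volume (Metric.closedBall q r₁ ∩ {x | (x, (1 : ℝ)) ∈ s}) +
       volume ((Metric.closedBall q r₃ \ Metric.closedBall q r₂) ∩ {x | (x, (-1 : ℝ)) ∈ s})) := by
  have h (y : ℝ) : Measurable fun x : EuclideanSpace ℝ (Fin n) => (x, y) := by fun_prop
  rw [ballShell, Measure.smul_apply, Measure.add_apply, Measure.map_apply (h _) hs,
    Measure.map_apply (h _) hs, Measure.restrict_apply (h _ hs), Measure.restrict_apply (h _ hs),
    smul_eq_mul, Set.inter_comm, Set.inter_comm (_ \ _)]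
  rfl

theorem isProbabilityMeasure_ballShell (h₁ : 0 < r₁) :
    IsProbabilityMeasure (ballShell q r₁ r₂ r₃) := by
  constructor
  rw [ballShell_apply MeasurableSet.univ]
  simp only [Set.mem_univ, Set.ofPred_true, Set.inter_univ]
  refine ENNReal.inv_mul_cancel (fun h => ?_) volume_closedBall_add_ne_top
  exact (Metric.measure_closedBall_pos volume q h₁).ne' (add_eq_zero.1 h).1

theorem ae_ballShell {s : Set (Labelled n)} (hs : MeasurableSet s)
    (h₁ : ∀ x ∈ Metric.closedBall q r₁, (x, (1 : ℝ)) ∈ s)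
    (h₂ : ∀ x ∈ Metric.closedBall q r₃ \ Metric.closedBall q r₂, (x, (-1 : ℝ)) ∈ s) :
    ∀ᵐ p ∂ballShell q r₁ r₂ r₃, p ∈ s := by
  change ballShell q r₁ r₂ r₃ sᶜ = 0
  rw [ballShell_apply hs.compl]
  have e₁ : Metric.closedBall q r₁ ∩ {x | (x, (1 : ℝ)) ∈ sᶜ} = ∅ :=
    Set.eq_empty_of_forall_notMem fun x hx => hx.2 (h₁ x hx.1)
  have e₂ : (Metric.closedBall q r₃ \ Metric.closedBall q r₂) ∩ {x | (x, (-1 : ℝ)) ∈ sᶜ} = ∅ :=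
    Set.eq_empty_of_forall_notMem fun x hx => hx.2 (h₂ x hx.1)
  rw [e₁, e₂]
  simp

/-- Both alternatives are closed conditions holding almost everywhere. The second is not strict
because the support may contain the inner boundary sphere of the shell. -/
theorem norm_le_or_le_norm_of_mem_support {p : Labelled n}
    (hp : p ∈ (ballShell q r₁ r₂ r₃).support) :
    (‖p.1 - q‖ ≤ r₁ ∧ p.2 = 1) ∨ (r₂ ≤ ‖p.1 - q‖ ∧ p.2 = -1) := by
  have hC : IsClosed {p : Labelled n |
      (‖p.1 - q‖ ≤ r₁ ∧ p.2 = 1) ∨ (r₂ ≤ ‖p.1 - q‖ ∧ p.2 = -1)} := by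
    have h : Continuous fun p : Labelled n => ‖p.1 - q‖ := by fun_prop
    exact ((isClosed_le h continuous_const).inter (isClosed_eq continuous_snd continuous_const)).union
      ((isClosed_le continuous_const h).inter (isClosed_eq continuous_snd continuous_const))
  refine Measure.support_subset_of_ae_mem hC
    (ae_ballShell hC.measurableSet (fun x hx => ?_) (fun x hx => ?_)) hp
  · exact Or.inl ⟨by simpa [dist_eq_norm] using hx, rfl⟩
  · refine Or.inr ⟨?_, rfl⟩
    have := hx.2
    simp only [Metric.mem_closedBall, dist_eq_norm, not_le] at this
    exact this.le

theorem ballShell_mem_separatedDistributions (h₁ : 0 < r₁)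
    (hcube : ∀ x ∈ Metric.closedBall q r₃, ∀ i, x i ∈ Set.Icc (0 : ℝ) 1) (h₁₃ : r₁ ≤ r₃) :
    ballShell q r₁ r₂ r₃ ∈ separatedDistributions n (r₂ - r₁) := by
  refine ⟨isProbabilityMeasure_ballShell h₁,
    ae_ballShell (isClosed_dataSpace n).measurableSet
      (fun x hx => ⟨hcube x (Metric.closedBall_subset_closedBall h₁₃ hx), Or.inr rfl⟩)
      (fun x hx => ⟨hcube x hx.1, Or.inl rfl⟩), fun p hp p' hp' hp1 hp'1 => ?_⟩
  rcases norm_le_or_le_norm_of_mem_support hp with h | h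
  · rcases norm_le_or_le_norm_of_mem_support hp' with h' | h'
    · norm_num [h'.2] at hp'1
    · have := norm_sub_norm_le (p'.1 - q) (p.1 - q)
      rw [sub_sub_sub_cancel_right, norm_sub_rev p'.1 p.1] at this
      linarith [h.1, h'.1]
  · norm_num [h.2] at hp1

theorem accuracy_ballShell (F : Network n) :
    accuracy (ballShell q r₁ r₂ r₃) F =
      (volume.real (Metric.closedBall q r₁) +
        volume.real (Metric.closedBall q r₃ \ Metric.closedBall q r₂))⁻¹ *
      (volume.real (Metric.closedBall q r₁ ∩ {x | 0 < F.eval x.ofLp}) +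
        volume.real ((Metric.closedBall q r₃ \ Metric.closedBall q r₂) ∩
          {x | F.eval x.ofLp < 0})) := by
  have hF : Measurable fun p : Labelled n => F.eval p.1.ofLp :=
    (F.continuous_eval.comp (by fun_prop : Continuous fun p : Labelled n => p.1.ofLp)).measurable
  have hs : Measurable Real.sign := by
    unfold Real.sign
    exact Measurable.ite measurableSet_Iio measurable_const
      (Measurable.ite measurableSet_Ioi measurable_const measurable_const)
  have hm : MeasurableSet {p : Labelled n | F.Correct p} :=
    measurableSet_eq_fun (hs.comp hF) measurable_snd
  have e₁ (y : ℝ) : Real.sign y = 1 ↔ 0 < y := by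
    unfold Real.sign
    split_ifs with h h'
    · norm_num
      exact h.le
    · simpa using h'
    · simpa using h'
  have e₂ (y : ℝ) : Real.sign y = -1 ↔ y < 0 := by
    unfold Real.sign
    split_ifs with h h'
    · simpa using h
    · norm_num
      exact h'.le
    · norm_num
      exact not_lt.1 h
  rw [accuracy, measureReal_def, ballShell_apply hm, ENNReal.toReal_mul, ENNReal.toReal_inv,
    ENNReal.toReal_add measure_closedBall_lt_top.ne
      ((measure_mono Set.sdiff_subset).trans_lt measure_closedBall_lt_top).ne,
    ENNReal.toReal_add
      ((measure_mono Set.inter_subset_left).trans_lt measure_closedBall_lt_top).ne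
      ((measure_mono (Set.inter_subset_left.trans Set.sdiff_subset)).trans_lt
        measure_closedBall_lt_top).ne]
  simp only [Set.mem_ofPred_eq, Network.Correct, e₁, e₂]
  rfl

end BallShell

/-! ### The accuracy bound -/

theorem volumeReal_closedBall {n : ℕ} (q : EuclideanSpace ℝ (Fin n)) {r : ℝ} (hr : 0 ≤ r) :
    volume.real (Metric.closedBall q r) =
      r ^ n * volume.real (Metric.ball (0 : EuclideanSpace ℝ (Fin n)) 1) := by
  rw [measureReal_def, Measure.addHaar_closedBall _ _ hr, ENNReal.toReal_mul,
    ENNReal.toReal_ofReal (by positivity), finrank_euclideanSpace_fin]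
  rfl

/-- On a ball and a shell whose outer ball has twice the volume of the inner one, a network
invariant under translations along a subspace of dimension `d` has nearly trivial accuracy. -/
theorem accuracy_ballShell_le {n d : ℕ} {q : EuclideanSpace ℝ (Fin n)} {r₁ ρ μ : ℝ}
    (h₁ : 0 < r₁) (hρ : 1 ≤ ρ) (hμ : 1 ≤ μ) (hμn : μ ^ n = 2) (F : Network n)
    (K : Submodule ℝ (EuclideanSpace ℝ (Fin n))) (hd : d ≤ Module.finrank ℝ K)
    (hK : ∀ x, ∀ k ∈ K, F.eval (x + k).ofLp = F.eval x.ofLp) :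
    accuracy (ballShell q r₁ (ρ * r₁) (μ * (ρ * r₁))) F ≤
      (1 + ρ ^ n)⁻¹ * (ρ ^ n + max (2 - μ ^ d) 0) := by
  set B₁ := Metric.closedBall q r₁
  set B₂ := Metric.closedBall q (ρ * r₁)
  set B₃ := Metric.closedBall q (μ * (ρ * r₁))
  set A := {x : EuclideanSpace ℝ (Fin n) | 0 < F.eval x.ofLp}
  have h₁₂ : r₁ ≤ ρ * r₁ := le_mul_of_one_le_left h₁.le hρ
  have h₂₃ : ρ * r₁ ≤ μ * (ρ * r₁) := le_mul_of_one_le_left (by linarith) hμ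
  have s₁₂ : B₁ ⊆ B₂ := Metric.closedBall_subset_closedBall h₁₂
  have s₂₃ : B₂ ⊆ B₃ := Metric.closedBall_subset_closedBall h₂₃
  have hAm : MeasurableSet A := measurableSet_lt measurable_const
    (F.continuous_eval.comp (PiLp.continuous_ofLp 2 _)).measurable
  have hB₂ : MeasurableSet B₂ := measurableSet_closedBall
  have fin {s : Set (EuclideanSpace ℝ (Fin n))} (h : s ⊆ B₃) : volume s ≠ ⊤ :=
    ((measure_mono h).trans_lt measure_closedBall_lt_top).ne
  set v := volume.real (Metric.ball (0 : EuclideanSpace ℝ (Fin n)) 1)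
  have hv : 0 < v :=
    ENNReal.toReal_pos (Metric.measure_ball_pos _ _ one_pos).ne' measure_ball_lt_top.ne
  have V₁ : volume.real B₁ = r₁ ^ n * v := volumeReal_closedBall q h₁.le
  have V₂ : volume.real B₂ = ρ ^ n * (r₁ ^ n * v) := by
    rw [volumeReal_closedBall q (by linarith)]; ring
  have V₃ : volume.real B₃ = 2 * (ρ ^ n * (r₁ ^ n * v)) := by
    rw [volumeReal_closedBall q (by linarith), mul_pow, mul_pow, hμn]; ring
  have Vs : volume.real (B₃ \ B₂) = ρ ^ n * (r₁ ^ n * v) := by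
    rw [measureReal_sdiff s₂₃ hB₂ (fin subset_rfl), V₂, V₃]; ring
  have hdil : μ ^ d * volume.real (B₂ ∩ A) ≤ volume.real (B₃ ∩ A) := by
    have h := pow_finrank_mul_measure_closedBall_inter_le volume K (A := A)
      (fun x hx k hk => by simpa only [A, Set.mem_ofPred_eq, hK x k hk] using hx) hμ q (ρ * r₁)
    have h' := ENNReal.toReal_mono (fin Set.inter_subset_left) h
    rw [ENNReal.toReal_mul, ENNReal.toReal_ofReal (by positivity)] at h'
    exact (mul_le_mul_of_nonneg_right (pow_le_pow_right₀ hμ hd) measureReal_nonneg).trans h'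
  have hshellA : volume.real ((B₃ \ B₂) ∩ A) = volume.real (B₃ ∩ A) - volume.real (B₂ ∩ A) := by
    rw [← measureReal_sdiff (Set.inter_subset_inter_left A s₂₃) (hB₂.inter hAm)
      (fin Set.inter_subset_left)]
    congr 1
    ext x
    simp only [Set.mem_inter_iff, Set.mem_sdiff]
    tauto
  -- Only an inequality: zeros of `F` are in neither set.
  have hsplit : volume.real ((B₃ \ B₂) ∩ {x | F.eval x.ofLp < 0}) +
      volume.real ((B₃ \ B₂) ∩ A) ≤ volume.real (B₃ \ B₂) := by
    rw [← measureReal_union _ ((measurableSet_closedBall.diff hB₂).inter hAm)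
      (fin (Set.inter_subset_left.trans Set.sdiff_subset))
      (fin (Set.inter_subset_left.trans Set.sdiff_subset))]
    · exact measureReal_mono (Set.union_subset Set.inter_subset_left Set.inter_subset_left)
        (fin Set.sdiff_subset)
    · exact Set.disjoint_left.2 fun x hx hx' => lt_asymm (show F.eval x.ofLp < 0 from hx.2) hx'.2
  have hmono : volume.real (B₁ ∩ A) ≤ volume.real (B₂ ∩ A) :=
    measureReal_mono (Set.inter_subset_inter_left A s₁₂) (fin (Set.inter_subset_left.trans s₂₃))
  have hle : volume.real (B₁ ∩ A) ≤ r₁ ^ n * v :=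
    V₁ ▸ measureReal_mono Set.inter_subset_left (fin (s₁₂.trans s₂₃))
  have h1d : 1 ≤ μ ^ d := one_le_pow₀ hμ
  have hnum : volume.real (B₁ ∩ A) + volume.real ((B₃ \ B₂) ∩ {x | F.eval x.ofLp < 0}) ≤
      (ρ ^ n + max (2 - μ ^ d) 0) * (r₁ ^ n * v) := by
    -- The shell contains at least `(μ ^ d - 1)` times the measure of `B₂ ∩ A`, hence of `B₁ ∩ A`;
    -- the net gain over the shell volume is at most `2 - μ ^ d` times the measure of `B₁ ∩ A`.
    have ha : (2 - μ ^ d) * volume.real (B₁ ∩ A) ≤ max (2 - μ ^ d) 0 * (r₁ ^ n * v) :=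
      mul_le_mul (le_max_left _ _) hle measureReal_nonneg (le_max_right _ _)
    have hb : (μ ^ d - 1) * volume.real (B₁ ∩ A) ≤ (μ ^ d - 1) * volume.real (B₂ ∩ A) :=
      mul_le_mul_of_nonneg_left hmono (by linarith)
    linarith
  have hu : 0 < r₁ ^ n * v := by positivity
  rw [accuracy_ballShell, V₁, Vs]
  calc _ ≤ (r₁ ^ n * v + ρ ^ n * (r₁ ^ n * v))⁻¹ *
        ((ρ ^ n + max (2 - μ ^ d) 0) * (r₁ ^ n * v)) :=
        mul_le_mul_of_nonneg_left hnum (by positivity)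
    _ = _ := by
      have : 0 < 1 + ρ ^ n := by positivity
      field_simp

/-! ### Choice of dimension and radii -/

theorem mainTheorem4 (w : ℕ) (hw : 0 < w)
    (L : (n : ℕ) → Finset (Labelled n) → Network n) (hL : IsMemorizationAlgorithm L)
    (hwidth : ∀ n : ℕ, 0 < n → ∀ S : Finset (Labelled n), IsDataset S → (L n S).width ≤ w) :
    ∃ n : ℕ, w < n ∧ ∃ c : ℝ, 0 < c ∧ ∃ D ∈ separatedDistributions n c,
      (∃ (q : EuclideanSpace ℝ (Fin n)) (r₁ r₂ r₃ : ℝ),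
        0 < r₁ ∧ r₁ < r₂ ∧ r₂ < r₃ ∧ D = ballShell q r₁ r₂ r₃) ∧
      ∀ (N : ℕ) (s : Fin N → Labelled n),
        s ∈ (Measure.pi fun _ : Fin N => D).support →
          accuracy D (L n (sampleSet s)) ≤ 0.51 := by
  have hn : 1000 * w ≠ 0 := by omega
  obtain ⟨ρ, hρ, hρn⟩ := exists_one_lt_pow_eq (a := 1.01) (by norm_num) hn
  obtain ⟨μ, hμ, hμn⟩ := exists_one_lt_pow_eq (a := 2) (by norm_num) hn
  have hμd : 1.998 ≤ μ ^ (999 * w) := by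
    -- By Bernoulli `1.001 ^ 1000 ≥ 2`, while `(μ ^ w) ^ 1000 = 2`.
    have h1 : μ ^ w ≤ 1.001 := by
      by_contra! h
      have h2 : (1.001 : ℝ) ^ 1000 < (μ ^ w) ^ 1000 :=
        pow_lt_pow_left₀ h (by norm_num) (by norm_num)
      have h3 := one_add_mul_le_pow (a := (0.001 : ℝ)) (by norm_num) 1000
      rw [← pow_mul, mul_comm, hμn] at h2
      norm_num at h2 h3
      exact absurd h2 (not_lt.2 h3)
    have h2 : μ ^ (999 * w) * μ ^ w = 2 := by
      rw [← pow_add, ← hμn]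
      congr 1
      ring
    have h3 : 0 < μ ^ (999 * w) := by positivity
    nlinarith
  -- Makes the outer radius 1/2, so that the outer ball is inscribed in the unit cube.
  set r₁ : ℝ := 1 / (2 * (μ * ρ)) with hr₁
  have h₁ : 0 < r₁ := by positivity
  have h₁₂ : r₁ < ρ * r₁ := lt_mul_of_one_lt_left h₁ hρ
  have h₂₃ : ρ * r₁ < μ * (ρ * r₁) := lt_mul_of_one_lt_left (h₁.trans h₁₂) hμ
  have h₃ : μ * (ρ * r₁) = 1 / 2 := by
    rw [hr₁]
    field_simp
  set q : EuclideanSpace ℝ (Fin (1000 * w)) := WithLp.toLp 2 fun _ => (1 / 2 : ℝ)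
  have hD := ballShell_mem_separatedDistributions (r₂ := ρ * r₁) (q := q) h₁
    (r₃ := μ * (ρ * r₁)) (fun x hx i => mem_Icc_of_mem_closedBall_half (by rwa [h₃] at hx) i)
    (h₁₂.trans h₂₃).le
  refine ⟨1000 * w, by omega, ρ * r₁ - r₁, sub_pos.2 h₁₂, _, hD,
    ⟨q, r₁, ρ * r₁, μ * (ρ * r₁), h₁, h₁₂, h₂₃, rfl⟩, fun N s hs => ?_⟩
  have := hD.1
  have hsupp := Measure.apply_mem_support_of_mem_support_pi hs
  -- The width bound applies only to datasets; the gap between the radii excludes conflicting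
  -- labels.
  have hdata : IsDataset (sampleSet s) := by
    refine isDataset_sampleSet
      (fun i => Measure.support_subset_of_ae_mem (isClosed_dataSpace _) hD.2.1 (hsupp i))
      fun i j hij => ?_
    have hi := norm_le_or_le_norm_of_mem_support (hsupp i)
    have hj := norm_le_or_le_norm_of_mem_support (hsupp j)
    rw [hij] at hi
    rcases hi with hi | hi <;> rcases hj with hj | hj
    · rw [hi.2, hj.2]
    · linarith [hi.1, hj.1]
    · linarith [hi.1, hj.1]
    · rw [hi.2, hj.2]
  obtain ⟨K, hKd, hK⟩ := (L _ (sampleSet s)).exists_submodule_eval_add hw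
    (hwidth _ (by omega) _ hdata)
  -- The bound is at most `(1.01 + 0.002) / 2.01 < 0.504`.
  refine (accuracy_ballShell_le (d := 999 * w) h₁ hρ.le hμ.le hμn _ K (by omega) hK).trans ?_
  rw [hρn]
  have : max (2 - μ ^ (999 * w)) 0 ≤ 0.002 := max_le (by linarith) (by norm_num)
  linarith
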